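/- Let $B_n$ denote the Bernoulli numbers, defined by $\frac{x}{e^x-1}=\sum_{n\ge 0}B_n\frac{x^n}{n!}$, and let $v_p$ denote the $p$-adic valuation on $\mathbb{Q}_p$, with $v_p(p)=1$ and $v_p(0)=+\infty$. Let $p$ be an odd prime and let $k$ be an even residue class modulo $p-1$. Then there exist coefficients $a_i(p,k)\in\mathbb{Q}_p$, $i=0,1,2,\ldots$, such that for every non-negative integer $n$ with $n\equiv k \pmod{p-1}$ the series $\sum_{i\ge 0}a_i(p,k)\,n^i$ (with $0^0=1$) converges in $\mathbb{Q}_p$ and $$B_n=(1-p^{n-1})^{-1}\sum_{i\ge 0}a_i(p,k)\,n^i ,$$ and such that the following conditions hold: 1. $a_0(p,k)=1-\frac1p$ if $k\equiv 0\pmod{p-1}$, and $a_0(p,k)=0$ otherwise; 2. $v_p(a_i(p,k))\ge \frac{p-2}{p-1}\,i-2$ for all $i\ge 0$; 3. $v_p(a_i(p,k))\ge i-1$ for all $i\ge 0$ with $p\ge i+2$. -/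

import Mathlib

/-! Removing a = 0 from the multiplication theorem ∑_{a<p} p^n B_n(a/p) = p B_n leaves (p - p^n) B_n
as a sum over units mod p. Writing a = tp + ω(a) with ω the Teichmüller character, the Appell
identity gives p^n B_n(a/p) = ∑_j C(n,j) p^j ω(a)^(n-j) B_j(t), and ω(a)^n depends only on n mod p -
1. So (1 - p^(n-1)) B_n is a Newton series ∑_j d_j n(n-1)⋯(n-j+1), with d_j independent of n within
its class (`Padic.euler_factor_mul_bernoulli`).

By von Staudt-Clausen, v(d_j) ≥ j - 2 - v(j!), with one unit more for j ≤ p - 2. Hence d_j → 0, and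
expanding falling factorials into powers gives the a_i (`Padic.hasSum_newtonCoeff_mul_pow`). The
expansion has integer coefficients and a_i involves only j ≥ i, so the bounds pass from d_j to a_i.
-/

/-! ### Bernoulli polynomial identities -/

theorem Polynomial.aeval_one_div_factorial_smul {K : Type*} [Field K] [Algebra ℚ K] (t : K)
    (n : ℕ) (f : Polynomial ℚ) :
    Polynomial.aeval t ((1 / n.factorial : ℚ) • f) =
      (1 / n.factorial : K) * Polynomial.aeval t f := by
  rw [map_smul, Algebra.smul_def, map_div₀, map_one, map_natCast]

/-- The Bernoulli polynomials form an Appell sequence. -/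
theorem Polynomial.aeval_add_bernoulli {K : Type*} [Field K] [Algebra ℚ K] (x y : K) (n : ℕ) :
    Polynomial.aeval (x + y) (Polynomial.bernoulli n) =
      ∑ j ∈ Finset.range (n + 1),
        (n.choose j : K) * Polynomial.aeval x (Polynomial.bernoulli j) * y ^ (n - j) := by
  have : CharZero K := algebraRat.charZero K
  have hexp : PowerSeries.exp K - 1 ≠ 0 := fun h => by
    simpa [PowerSeries.coeff_one] using congrArg (PowerSeries.coeff 1) h
  have h : (PowerSeries.mk fun n => Polynomial.aeval (x + y)
        ((1 / n.factorial : ℚ) • Polynomial.bernoulli n)) =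
      (PowerSeries.mk fun n => Polynomial.aeval x
        ((1 / n.factorial : ℚ) • Polynomial.bernoulli n)) *
        PowerSeries.rescale y (PowerSeries.exp K) := by
    apply mul_right_cancel₀ hexp
    rw [mul_right_comm, Polynomial.bernoulli_generating_function,
      Polynomial.bernoulli_generating_function, mul_assoc, PowerSeries.exp_mul_exp_eq_exp_add]
  have h2 := congrArg (PowerSeries.coeff n) h
  have hn : ∀ m : ℕ, (m.factorial : K) ≠ 0 := fun m => Nat.cast_ne_zero.2 m.factorial_ne_zero
  rw [PowerSeries.coeff_mul, Finset.Nat.sum_antidiagonal_eq_sum_range_succ_mk] at h2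
  simp only [PowerSeries.coeff_mk, PowerSeries.coeff_rescale, PowerSeries.coeff_exp,
    Polynomial.aeval_one_div_factorial_smul, map_div₀, map_one, map_natCast] at h2
  have h3 := congrArg (fun z => (n.factorial : K) * z) h2
  rw [← mul_assoc, mul_one_div_cancel (hn n), one_mul] at h3
  rw [h3, Finset.mul_sum]
  refine Finset.sum_congr rfl fun j hj => ?_
  rw [Nat.cast_choose K (Nat.lt_succ_iff.1 (Finset.mem_range.1 hj))]
  have := hn j
  have := hn (n - j)
  field_simp

/-- The multiplication theorem for Bernoulli polynomials at the origin. -/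
theorem Polynomial.sum_aeval_div_bernoulli {K : Type*} [Field K] [Algebra ℚ K] {m : ℕ}
    (hm : m ≠ 0) (n : ℕ) :
    ∑ a ∈ Finset.range m,
      (m : K) ^ n * Polynomial.aeval ((a : K) / m) (Polynomial.bernoulli n) =
      (m : K) * algebraMap ℚ K (_root_.bernoulli n) := by
  have : CharZero K := algebraRat.charZero K
  have hmK : (m : K) ≠ 0 := Nat.cast_ne_zero.2 hm
  set E := PowerSeries.exp K with hE
  have hexp : E - 1 ≠ 0 := fun h => by
    simpa [hE, PowerSeries.coeff_one] using congrArg (PowerSeries.coeff 1) h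
  have hexpm : PowerSeries.rescale (m : K) E - 1 ≠ 0 := fun h => by
    simpa [hE, PowerSeries.coeff_one, hm] using congrArg (PowerSeries.coeff 1) h
  let F : K → PowerSeries K := fun t =>
    PowerSeries.mk fun n => Polynomial.aeval t ((1 / n.factorial : ℚ) • Polynomial.bernoulli n)
  have hF : ∀ t, F t * (E - 1) = PowerSeries.X * PowerSeries.rescale t E :=
    Polynomial.bernoulli_generating_function
  have hpow : ∀ a : ℕ, PowerSeries.rescale (a : K) E = E ^ a := fun a =>
    (PowerSeries.exp_pow_eq_rescale_exp a).symm
  have h : ∑ a ∈ Finset.range m, PowerSeries.rescale (m : K) (F ((a : K) / m)) =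
      PowerSeries.C (m : K) * F 0 := by
    -- Clearing both denominators of the generating functions turns the left side into a geometric
    -- sum in e^x.
    apply mul_right_cancel₀ hexpm
    apply mul_right_cancel₀ hexp
    have h1 : ∀ a ∈ Finset.range m, PowerSeries.rescale (m : K) (F ((a : K) / m)) *
        (PowerSeries.rescale (m : K) E - 1) =
        PowerSeries.C (m : K) * PowerSeries.X * E ^ a := fun a _ => by
      have := congrArg (PowerSeries.rescale (m : K)) (hF ((a : K) / m))
      rw [map_mul, map_mul, map_sub, map_one, PowerSeries.rescale_rescale,
        div_mul_cancel₀ _ hmK, PowerSeries.rescale_X, hpow a] at this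
      exact this
    rw [Finset.sum_mul, Finset.sum_congr rfl h1, ← Finset.mul_sum, mul_assoc, geom_sum_mul,
      mul_right_comm _ (PowerSeries.rescale (m : K) E - 1), mul_assoc _ (F 0), hF 0, hpow m]
    simp [hE]
  have h2 := congrArg (PowerSeries.coeff n) h
  have hn : (n.factorial : K) ≠ 0 := Nat.cast_ne_zero.2 n.factorial_ne_zero
  simp only [F, map_sum, PowerSeries.coeff_C_mul, PowerSeries.coeff_mk, PowerSeries.coeff_rescale,
    Polynomial.aeval_one_div_factorial_smul] at h2
  have h3 := congrArg (fun z => (n.factorial : K) * z) h2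
  simp only [Finset.mul_sum] at h3
  have h0 : Polynomial.aeval (0 : K) (Polynomial.bernoulli n) =
      algebraMap ℚ K (_root_.bernoulli n) := by
    rw [← map_zero (algebraMap ℚ K), Polynomial.aeval_algebraMap_apply,
      Polynomial.coe_aeval_eq_eval, Polynomial.bernoulli_eval_zero]
  rw [h0] at h3
  convert h3 using 1
  · refine Finset.sum_congr rfl fun a _ => ?_
    field_simp
  · field_simp

/-! ### Integrality from von Staudt-Clausen -/

section Bernoulli
variable {p : ℕ} [Fact p.Prime]

theorem Padic.norm_natCast_prime_inv {q : ℕ} (hq : q.Prime) (hqp : q ≠ p) :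
    ‖((1 / q : ℚ) : ℚ_[p])‖ = 1 := by
  have h : ‖(q : ℚ_[p])‖ = 1 := by
    rw [Padic.norm_natCast_eq_one_iff]
    exact (Nat.coprime_primes Fact.out hq).2 hqp.symm
  simp [h]

/-- Only the summand 1/p of von Staudt-Clausen fails to be p-integral, and it can occur only if p <
n + 2. The parameter `C` covers both the bound 1 and the bound p. -/
theorem Padic.norm_bernoulli_le_of_forall (hp : Odd p) {C : ℝ} (hC : 1 ≤ C) (n : ℕ)
    (h : p < n + 2 → (p : ℝ) ≤ C) : ‖((bernoulli n : ℚ) : ℚ_[p])‖ ≤ C := by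
  rcases Nat.even_or_odd' n with ⟨k, rfl | rfl⟩
  · obtain ⟨z, hz⟩ := Bernoulli.vonStaudt_clausen k
    have hB : bernoulli (2 * k) = z - ∑ q ∈ Finset.range (2 * k + 2) with
        q.Prime ∧ (q - 1) ∣ 2 * k, (1 : ℚ) / q := by rw [hz]; ring
    rw [hB, Rat.cast_sub, Rat.cast_intCast, Rat.cast_sum, sub_eq_add_neg]
    refine (IsUltrametricDist.norm_add_le_max _ _).trans
      (max_le ((Padic.norm_int_le_one z).trans hC) ?_)
    rw [norm_neg]
    refine IsUltrametricDist.norm_sum_le_of_forall_le_of_nonneg (by linarith) fun q hq => ?_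
    simp only [Finset.mem_filter, Finset.mem_range] at hq
    by_cases hqp : q = p
    · subst hqp
      simpa using h hq.1
    · rw [Padic.norm_natCast_prime_inv hq.2.1 hqp]
      exact hC
  · rcases Nat.eq_zero_or_pos k with rfl | hk
    · have h2 : ‖((1 / (2 : ℕ) : ℚ) : ℚ_[p])‖ = 1 :=
        Padic.norm_natCast_prime_inv Nat.prime_two (by rintro rfl; exact absurd hp (by decide))
      have : bernoulli (2 * 0 + 1) = -(1 / (2 : ℕ) : ℚ) := by simp [bernoulli_one, neg_div]
      rw [this, Rat.cast_neg, norm_neg, h2]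
      exact hC
    · rw [bernoulli_eq_zero_of_odd ⟨k, rfl⟩ (by omega)]
      simpa using zero_le_one.trans hC

/-- The values of the Bernoulli polynomials on `p`-adic integers are bounded by `p`, and by `1` in
degree at most `p - 2`. -/
theorem Padic.norm_aeval_bernoulli_le (hp : Odd p) {C : ℝ} (hC : 1 ≤ C) (n : ℕ)
    (h : p < n + 2 → (p : ℝ) ≤ C) {t : ℚ_[p]} (ht : ‖t‖ ≤ 1) :
    ‖Polynomial.aeval t (Polynomial.bernoulli n)‖ ≤ C := by
  rw [Polynomial.bernoulli_def, map_sum]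
  refine IsUltrametricDist.norm_sum_le_of_forall_le_of_nonneg (by linarith) fun i hi => ?_
  rw [Finset.mem_range] at hi
  rw [Polynomial.aeval_monomial, norm_mul, norm_pow, map_mul, norm_mul]
  have h1 : ‖algebraMap ℚ ℚ_[p] (bernoulli (n - i))‖ ≤ C :=
    Padic.norm_bernoulli_le_of_forall hp hC _ fun h' => h (by omega)
  have h2 : ‖algebraMap ℚ ℚ_[p] (n.choose i)‖ ≤ 1 := by
    rw [map_natCast]; exact_mod_cast Padic.norm_int_le_one (n.choose i : ℤ)
  calc _ ≤ C * 1 * 1 := by gcongr; exact pow_le_one₀ (norm_nonneg _) ht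
    _ = C := by ring
end Bernoulli

/-! ### The Teichmüller character -/

section Teichmuller
variable (p : ℕ) [Fact p.Prime]

/-- A p-adic integer is a natural number plus a multiple of p, and p maps to 0. -/
theorem PadicInt.ringHom_zmod_ext (f g : ℤ_[p] →+* ZMod p) : f = g := by
  ext x
  obtain ⟨y, hy⟩ : (p : ℤ_[p]) ∣ x - (x.zmodRepr : ℤ_[p]) := by
    have := PadicInt.sub_zmodRepr_mem x
    rwa [PadicInt.maximalIdeal_eq_span_p, Ideal.mem_span_singleton] at this
  rw [eq_add_of_sub_eq hy]
  simp

/-- The Teichmüller character. -/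
noncomputable def PadicInt.teichmuller : ZMod p →* ℤ_[p] :=
  (WittVector.equiv p : WittVector p (ZMod p) →* ℤ_[p]).comp (WittVector.teichmuller p)

theorem PadicInt.toZMod_teichmuller (x : ZMod p) :
    PadicInt.toZMod (PadicInt.teichmuller p x) = x := by
  have h := PadicInt.ringHom_zmod_ext p PadicInt.toZMod
    (WittVector.constantCoeff.comp ((WittVector.equiv p).symm : ℤ_[p] →+* WittVector p (ZMod p)))
  rw [h]
  simp [PadicInt.teichmuller, WittVector.constantCoeff]

/-- The Teichmüller character on units, with values in `ℚ_[p]`. -/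
noncomputable def Padic.teichmullerUnits : (ZMod p)ˣ →* ℚ_[p] :=
  (PadicInt.Coe.ringHom (p := p)).toMonoidHom.comp
    ((PadicInt.teichmuller p).comp (Units.coeHom (ZMod p)))

theorem Padic.teichmullerUnits_injective : Function.Injective (Padic.teichmullerUnits p) := by
  intro u v h
  have h' : PadicInt.teichmuller p u = PadicInt.teichmuller p v := Subtype.ext h
  apply Units.ext
  rw [← PadicInt.toZMod_teichmuller p u, h', PadicInt.toZMod_teichmuller]

theorem Padic.teichmullerUnits_pow_sub_one (u : (ZMod p)ˣ) :
    Padic.teichmullerUnits p u ^ (p - 1) = 1 := by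
  rw [← map_pow, ZMod.units_pow_card_sub_one_eq_one, map_one]

theorem Padic.norm_teichmullerUnits (u : (ZMod p)ˣ) : ‖Padic.teichmullerUnits p u‖ = 1 := by
  have h := congrArg norm (Padic.teichmullerUnits_pow_sub_one p u)
  rw [norm_pow, norm_one] at h
  have hp1 : p - 1 ≠ 0 := by have := (Fact.out : p.Prime).two_le; omega
  exact (pow_eq_one_iff_of_nonneg (norm_nonneg _) hp1).1 h

theorem Padic.exists_eq_teichmullerUnits_add (u : (ZMod p)ˣ) :
    ∃ t : ℚ_[p], ‖t‖ ≤ 1 ∧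
      (((u : ZMod p).val : ℕ) : ℚ_[p]) = t * p + Padic.teichmullerUnits p u := by
  have h : (((u : ZMod p).val : ℕ) : ℤ_[p]) - PadicInt.teichmuller p u ∈
      RingHom.ker (PadicInt.toZMod (p := p)) := by
    rw [RingHom.mem_ker, map_sub, PadicInt.toZMod_teichmuller]
    simp
  rw [PadicInt.ker_toZMod, PadicInt.maximalIdeal_eq_span_p, Ideal.mem_span_singleton] at h
  obtain ⟨t, ht⟩ := h
  refine ⟨t, t.2, ?_⟩
  have := congrArg (PadicInt.Coe.ringHom (p := p)) (eq_add_of_sub_eq ht)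
  simp only [map_add, map_mul, map_natCast] at this
  rw [this, mul_comm]
  rfl

theorem Padic.sum_teichmullerUnits_pow (k : ℕ) :
    ∑ u, Padic.teichmullerUnits p u ^ k = if p - 1 ∣ k then (p : ℚ_[p]) - 1 else 0 := by
  classical
  have hp := (Fact.out : p.Prime).two_le
  have h := sum_hom_units (Padic.teichmullerUnits p ^ k)
  have hone : Padic.teichmullerUnits p ^ k = 1 ↔ p - 1 ∣ k := by
    constructor
    · intro hk
      obtain ⟨g, hg⟩ := IsCyclic.exists_generator (α := (ZMod p)ˣ)
      have h1 : Padic.teichmullerUnits p (g ^ k) = Padic.teichmullerUnits p 1 := by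
        rw [map_pow, map_one]
        exact DFunLike.congr_fun hk g
      have h2 := orderOf_dvd_of_pow_eq_one (Padic.teichmullerUnits_injective p h1)
      rwa [orderOf_eq_card_of_forall_mem_zpowers hg, Nat.card_eq_fintype_card,
        ZMod.card_units] at h2
    · rintro ⟨m, rfl⟩
      ext u
      rw [MonoidHom.pow_apply, pow_mul, Padic.teichmullerUnits_pow_sub_one, one_pow,
        MonoidHom.one_apply]
  simp only [MonoidHom.pow_apply, hone, ZMod.card_units] at h
  rw [h]
  split_ifs
  · rw [Nat.cast_sub (by omega), Nat.cast_one]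
  · simp
end Teichmuller

/-! ### From Newton series to power series -/

section Newton
variable {p : ℕ} [Fact p.Prime]

/-- The power series coefficients of the Newton series `∑ d_j X (X - 1) ⋯ (X - j + 1)`. -/
noncomputable def Padic.newtonCoeff (d : ℕ → ℚ_[p]) (i : ℕ) : ℚ_[p] :=
  ∑' j, d j * ((descPochhammer ℤ j).coeff i : ℚ_[p])

theorem descPochhammer_coeff_eq_zero_of_lt {i j : ℕ} (h : j < i) :
    (descPochhammer ℤ j).coeff i = 0 :=
  Polynomial.coeff_eq_zero_of_natDegree_lt (by rwa [descPochhammer_natDegree])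

theorem Padic.norm_mul_intCast_le (x : ℚ_[p]) (z : ℤ) : ‖x * z‖ ≤ ‖x‖ := by
  rw [norm_mul]
  exact mul_le_of_le_one_right (norm_nonneg _) (Padic.norm_int_le_one z)

theorem Padic.norm_newtonCoeff_le {d : ℕ → ℚ_[p]} {i : ℕ} {C : ℝ} (hC : 0 ≤ C)
    (h : ∀ j, i ≤ j → ‖d j‖ ≤ C) : ‖Padic.newtonCoeff d i‖ ≤ C := by
  by_cases hs : Summable fun j => d j * ((descPochhammer ℤ j).coeff i : ℚ_[p])
  · refine le_of_tendsto hs.hasSum.norm (Filter.Eventually.of_forall fun s => ?_)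
    refine IsUltrametricDist.norm_sum_le_of_forall_le_of_nonneg hC fun j _ => ?_
    rcases lt_or_ge j i with hj | hj
    · simpa [descPochhammer_coeff_eq_zero_of_lt hj] using hC
    · exact (Padic.norm_mul_intCast_le _ _).trans (h j hj)
  -- A divergent `tsum` is 0 by convention, so no convergence hypothesis is needed.
  · rw [Padic.newtonCoeff, tsum_eq_zero_of_not_summable hs, norm_zero]
    exact hC

theorem Padic.newtonCoeff_zero (d : ℕ → ℚ_[p]) : Padic.newtonCoeff d 0 = d 0 := by
  rw [Padic.newtonCoeff, tsum_eq_single 0]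
  · simp
  · intro j hj
    rw [Polynomial.coeff_zero_eq_eval_zero, descPochhammer_ne_zero_eval_zero ℤ hj]
    simp

theorem Padic.hasSum_newtonCoeff_mul_pow {d : ℕ → ℚ_[p]}
    (hd : Filter.Tendsto d Filter.atTop (nhds 0)) (n : ℕ) :
    HasSum (fun i => Padic.newtonCoeff d i * (n : ℚ_[p]) ^ i)
      (∑ j ∈ Finset.range (n + 1), d j * (n.descFactorial j : ℚ_[p])) := by
  let f : ℕ × ℕ → ℚ_[p] := fun q =>
    d q.1 * (((descPochhammer ℤ q.1).coeff q.2 * (n : ℤ) ^ q.2 : ℤ) : ℚ_[p])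
  -- Ultrametric summability over pairs only needs terms tending to 0; it justifies exchanging the
  -- two sums.
  have hf : Summable f := by
    apply NonarchimedeanAddGroup.summable_of_tendsto_cofinite_zero
    rw [Metric.tendsto_nhds]
    intro ε hε
    rw [Filter.eventually_cofinite]
    rw [Metric.tendsto_atTop] at hd
    obtain ⟨N, hN⟩ := hd ε hε
    refine ((Finset.range N ×ˢ Finset.range N).finite_toSet).subset fun q hq => ?_
    simp only [Set.mem_ofPred_eq, dist_zero_right, not_lt] at hq hN
    have h1 : q.1 < N := by
      by_contra hlt
      exact absurd (hq.trans (Padic.norm_mul_intCast_le _ _)) (not_le.2 (hN _ (not_lt.1 hlt)))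
    have h2 : q.2 ≤ q.1 := by
      by_contra hlt
      simp only [f, descPochhammer_coeff_eq_zero_of_lt (not_le.1 hlt)] at hq
      simp at hq
      linarith
    simp only [Finset.coe_product, Set.mem_prod, Finset.coe_range, Set.mem_Iio]
    omega
  have hrow : ∀ j, HasSum (fun i => f (j, i)) (d j * (n.descFactorial j : ℚ_[p])) := fun j => by
    have h1 : (n.descFactorial j : ℤ) =
        ∑ i ∈ Finset.range (j + 1), (descPochhammer ℤ j).coeff i * (n : ℤ) ^ i := by
      rw [← descPochhammer_eval_eq_descFactorial, Polynomial.eval_eq_sum_range,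
        descPochhammer_natDegree]
    have h2 : d j * (n.descFactorial j : ℚ_[p]) = ∑ i ∈ Finset.range (j + 1), f (j, i) := by
      simp only [f]
      rw [← Finset.mul_sum, ← Int.cast_sum, ← h1, Int.cast_natCast]
    rw [h2]
    refine hasSum_sum_of_ne_finset_zero fun i hi => ?_
    rw [Finset.mem_range, not_lt] at hi
    simp [f, descPochhammer_coeff_eq_zero_of_lt (Nat.lt_of_succ_le hi)]
  have hsum : HasSum f (∑ j ∈ Finset.range (n + 1), d j * (n.descFactorial j : ℚ_[p])) := by
    have h1 := hf.hasSum.prod_fiberwise hrow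
    have h2 : HasSum (fun j => d j * (n.descFactorial j : ℚ_[p]))
        (∑ j ∈ Finset.range (n + 1), d j * (n.descFactorial j : ℚ_[p])) := by
      refine hasSum_sum_of_ne_finset_zero fun j hj => ?_
      rw [Finset.mem_range, not_lt] at hj
      simp [Nat.descFactorial_of_lt (Nat.lt_of_succ_le hj)]
    rw [← h1.unique h2]
    exact hf.hasSum
  have hswap : HasSum (f ∘ Prod.swap) _ := (Equiv.prodComm ℕ ℕ).hasSum_iff.2 hsum
  refine hswap.prod_fiberwise fun i => ?_
  have hcol : Summable fun j => f (j, i) :=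
    hf.comp_injective (i := fun j => (j, i)) fun a b h => (Prod.mk.inj h).1
  have hval : Padic.newtonCoeff d i * (n : ℚ_[p]) ^ i = ∑' j, f (j, i) := by
    rw [Padic.newtonCoeff, ← tsum_mul_right]
    refine tsum_congr fun j => ?_
    simp only [f]
    push_cast
    ring
  rw [hval]
  exact hcol.hasSum
end Newton

/-! ### The Newton coefficients of the Bernoulli numbers -/

section Coefficients
variable (p : ℕ) [Fact p.Prime]

/-- The `p`-adic integer `t` with `a = t * p + ω(a)`, where `0 < a < p` represents `u`. -/
noncomputable def Padic.teichmullerQuotient (u : (ZMod p)ˣ) : ℚ_[p] :=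
  (Padic.exists_eq_teichmullerUnits_add p u).choose

theorem Padic.norm_teichmullerQuotient_le (u : (ZMod p)ˣ) :
    ‖Padic.teichmullerQuotient p u‖ ≤ 1 :=
  (Padic.exists_eq_teichmullerUnits_add p u).choose_spec.1

theorem Padic.val_eq_teichmullerQuotient_mul_add (u : (ZMod p)ˣ) :
    (((u : ZMod p).val : ℕ) : ℚ_[p]) =
      Padic.teichmullerQuotient p u * p + Padic.teichmullerUnits p u :=
  (Padic.exists_eq_teichmullerUnits_add p u).choose_spec.2

/-- The twisted sum of values of the `j`-th Bernoulli polynomial. -/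
noncomputable def Padic.twistedBernoulliSum (k j : ℕ) : ℚ_[p] :=
  ∑ u, Padic.teichmullerUnits p u ^ k * (Padic.teichmullerUnits p u)⁻¹ ^ j *
    Polynomial.aeval (Padic.teichmullerQuotient p u) (Polynomial.bernoulli j)

/-- The Newton coefficients of `n ↦ (1 - p ^ (n - 1)) * B_n` on the class of `k` mod `p - 1`. -/
noncomputable def Padic.bernoulliNewton (k j : ℕ) : ℚ_[p] :=
  (p : ℚ_[p]) ^ j * Padic.twistedBernoulliSum p k j / (p * j.factorial)

variable {p}

theorem Padic.norm_twistedBernoulliSum_le (hp : Odd p) {C : ℝ} (hC : 1 ≤ C) (k j : ℕ)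
    (h : p < j + 2 → (p : ℝ) ≤ C) : ‖Padic.twistedBernoulliSum p k j‖ ≤ C := by
  refine IsUltrametricDist.norm_sum_le_of_forall_le_of_nonneg (by linarith) fun u _ => ?_
  rw [norm_mul, norm_mul, norm_pow, norm_pow, norm_inv, Padic.norm_teichmullerUnits]
  simpa using Padic.norm_aeval_bernoulli_le hp hC j h (Padic.norm_teichmullerQuotient_le p u)

theorem Padic.bernoulliNewton_zero (k : ℕ) :
    Padic.bernoulliNewton p k 0 = if p - 1 ∣ k then 1 - 1 / (p : ℚ_[p]) else 0 := by
  have hp0 : (p : ℚ_[p]) ≠ 0 := Nat.cast_ne_zero.2 (Fact.out : p.Prime).ne_zero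
  have h := Padic.sum_teichmullerUnits_pow p k
  simp only [Padic.bernoulliNewton, Padic.twistedBernoulliSum, Polynomial.bernoulli_zero, map_one,
    pow_zero, mul_one, one_mul, Nat.factorial_zero, Nat.cast_one, h]
  split_ifs
  · field_simp
  · simp

theorem Padic.pow_mul_aeval_bernoulli {k n : ℕ} (hn : n ≡ k [MOD p - 1]) (u : (ZMod p)ˣ) :
    (p : ℚ_[p]) ^ n *
        Polynomial.aeval (((u : ZMod p).val : ℕ) / (p : ℚ_[p])) (Polynomial.bernoulli n) =
      ∑ j ∈ Finset.range (n + 1), (n.choose j : ℚ_[p]) * (p : ℚ_[p]) ^ j *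
        (Padic.teichmullerUnits p u ^ k * (Padic.teichmullerUnits p u)⁻¹ ^ j *
          Polynomial.aeval (Padic.teichmullerQuotient p u) (Polynomial.bernoulli j)) := by
  have hp0 : (p : ℚ_[p]) ≠ 0 := Nat.cast_ne_zero.2 (Fact.out : p.Prime).ne_zero
  have hpow : Padic.teichmullerUnits p u ^ n = Padic.teichmullerUnits p u ^ k :=
    pow_eq_pow_of_modEq hn (Padic.teichmullerUnits_pow_sub_one p u)
  have hne : Padic.teichmullerUnits p u ≠ 0 := by
    rw [← norm_ne_zero_iff, Padic.norm_teichmullerUnits]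
    exact one_ne_zero
  rw [Padic.val_eq_teichmullerQuotient_mul_add, add_div, mul_div_cancel_right₀ _ hp0,
    Polynomial.aeval_add_bernoulli, Finset.mul_sum]
  refine Finset.sum_congr rfl fun j hj => ?_
  obtain ⟨m, rfl⟩ := Nat.exists_eq_add_of_le (Nat.lt_succ_iff.1 (Finset.mem_range.1 hj))
  rw [← hpow, Nat.add_sub_cancel_left, div_pow, pow_add, pow_add, inv_pow]
  field_simp

theorem Padic.sum_Ico_eq_sum_units {M : Type*} [AddCommMonoid M] (f : ℕ → M) :
    ∑ a ∈ Finset.Ico 1 p, f a = ∑ u : (ZMod p)ˣ, f (u : ZMod p).val :=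
  Finset.sum_bij'
    (fun a ha => Units.mk0 (a : ZMod p) (mt (ZMod.natCast_eq_zero_iff a p).mp (by
      rw [Finset.mem_Ico] at ha
      exact Nat.not_dvd_of_pos_of_lt ha.1 ha.2)))
    (fun u _ => (u : ZMod p).val)
    (fun _ _ => Finset.mem_univ _)
    (fun u _ => Finset.mem_Ico.2
      ⟨Nat.pos_of_ne_zero ((ZMod.val_ne_zero _).2 u.ne_zero), ZMod.val_lt _⟩)
    (fun a ha => by simp [ZMod.val_cast_of_lt (Finset.mem_Ico.mp ha).2])
    (fun u _ => Units.ext (ZMod.natCast_zmod_val _))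
    (fun a ha => by simp [ZMod.val_cast_of_lt (Finset.mem_Ico.mp ha).2])

theorem Padic.euler_factor_mul_bernoulli {k n : ℕ} (hn : n ≡ k [MOD p - 1]) :
    (1 - (p : ℚ_[p]) ^ ((n : ℤ) - 1)) * ((bernoulli n : ℚ) : ℚ_[p]) =
      ∑ j ∈ Finset.range (n + 1),
        Padic.bernoulliNewton p k j * (n.descFactorial j : ℚ_[p]) := by
  have hpp : p ≠ 0 := (Fact.out : p.Prime).ne_zero
  have hp0 : (p : ℚ_[p]) ≠ 0 := Nat.cast_ne_zero.2 hpp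
  have h := Polynomial.sum_aeval_div_bernoulli (K := ℚ_[p]) hpp n
  have h0 : Polynomial.aeval (0 : ℚ_[p]) (Polynomial.bernoulli n) =
      algebraMap ℚ ℚ_[p] (bernoulli n) := by
    rw [← map_zero (algebraMap ℚ ℚ_[p]), Polynomial.aeval_algebraMap_apply,
      Polynomial.coe_aeval_eq_eval, Polynomial.bernoulli_eval_zero]
  rw [Finset.range_eq_Ico, Finset.sum_eq_sum_Ico_succ_bot (Nat.pos_of_ne_zero hpp),
    Nat.cast_zero, zero_div, h0, eq_ratCast, zero_add, Padic.sum_Ico_eq_sum_units,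
    Finset.sum_congr rfl fun u _ => Padic.pow_mul_aeval_bernoulli hn u, Finset.sum_comm] at h
  rw [zpow_sub_one₀ hp0, zpow_natCast]
  apply mul_left_cancel₀ hp0
  rw [Finset.mul_sum]
  trans ((p : ℚ_[p]) * ((bernoulli n : ℚ) : ℚ_[p]) - p ^ n * ((bernoulli n : ℚ) : ℚ_[p]))
  · field_simp
  rw [← h, add_sub_cancel_left]
  refine Finset.sum_congr rfl fun j _ => ?_
  have hj : (j.factorial : ℚ_[p]) ≠ 0 := Nat.cast_ne_zero.2 j.factorial_ne_zero
  rw [← Finset.mul_sum, Padic.bernoulliNewton, Nat.descFactorial_eq_factorial_mul_choose,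
    Nat.cast_mul, Padic.twistedBernoulliSum]
  field_simp

theorem Padic.norm_bernoulliNewton_le (hp : Odd p) {c : ℤ} (hc : 0 ≤ c) (k j : ℕ)
    (h : p < j + 2 → 1 ≤ c) :
    ‖Padic.bernoulliNewton p k j‖ ≤
      (p : ℝ) ^ (c + 1 + (padicValNat p j.factorial : ℤ) - (j : ℤ)) := by
  have hp1 : (1 : ℝ) ≤ p := by exact_mod_cast (Fact.out : p.Prime).one_lt.le
  have hp0 : (p : ℝ) ≠ 0 := by positivity
  have hb : ‖Padic.twistedBernoulliSum p k j‖ ≤ (p : ℝ) ^ c :=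
    Padic.norm_twistedBernoulliSum_le hp (one_le_zpow₀ hp1 hc) k j fun h' => by
      simpa using zpow_le_zpow_right₀ hp1 (h h')
  have hf : ‖(j.factorial : ℚ_[p])‖ = (p : ℝ) ^ (-(padicValNat p j.factorial : ℤ)) := by
    rw [Padic.norm_eq_zpow_neg_valuation (Nat.cast_ne_zero.2 j.factorial_ne_zero),
      Padic.valuation_natCast]
  rw [Padic.bernoulliNewton, norm_div, norm_mul, norm_mul, norm_pow, Padic.norm_p, hf]
  calc _ ≤ ((p : ℝ)⁻¹ ^ j * (p : ℝ) ^ c) /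
        ((p : ℝ)⁻¹ * (p : ℝ) ^ (-(padicValNat p j.factorial : ℤ))) := by gcongr
    _ = _ := by
      rw [zpow_sub₀ hp0, zpow_add₀ hp0, zpow_add₀ hp0, zpow_one, zpow_neg, zpow_natCast,
        zpow_natCast, inv_pow]
      field_simp

theorem sub_one_mul_padicValNat_factorial_le (j : ℕ) :
    ((p : ℤ) - 1) * padicValNat p j.factorial ≤ j := by
  have h := sub_one_mul_padicValNat_factorial (p := p) j
  have h1 := (Fact.out : p.Prime).one_lt.le
  have h2 : (p - 1) * padicValNat p j.factorial ≤ j := h ▸ Nat.sub_le _ _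
  generalize padicValNat p j.factorial = v at h2 ⊢
  zify [h1] at h2
  exact h2

theorem Padic.tendsto_bernoulliNewton (hp : Odd p) (k : ℕ) :
    Filter.Tendsto (Padic.bernoulliNewton p k) Filter.atTop (nhds 0) := by
  have hp1 : (1 : ℝ) < p := by exact_mod_cast (Fact.out : p.Prime).one_lt
  have hp3 : 3 ≤ p := by
    have := (Fact.out : p.Prime).two_le
    rcases hp with ⟨m, rfl⟩
    omega
  have hlim : Filter.Tendsto (fun j : ℕ => (p : ℝ) ^ 2 * ((p : ℝ)⁻¹) ^ (j / 2)) Filter.atTop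
      (nhds ((p : ℝ) ^ 2 * 0)) :=
    ((tendsto_pow_atTop_nhds_zero_of_lt_one (by positivity) (inv_lt_one_of_one_lt₀ hp1)).comp
      (Nat.tendsto_div_const_atTop two_ne_zero)).const_mul _
  rw [mul_zero] at hlim
  refine squeeze_zero_norm (fun j => ?_) hlim
  refine (Padic.norm_bernoulliNewton_le hp zero_le_one k j fun _ => le_rfl).trans ?_
  have hv := sub_one_mul_padicValNat_factorial_le (p := p) j
  -- Oddness enters here: p ≥ 3 leaves at least j/2 of the factor p^j after division by j!.
  have hv2 : 2 * (padicValNat p j.factorial : ℤ) ≤ j := by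
    have : (3 : ℤ) ≤ p := by exact_mod_cast hp3
    nlinarith [Int.natCast_nonneg (padicValNat p j.factorial)]
  calc _ ≤ (p : ℝ) ^ ((2 : ℤ) - ((j / 2 : ℕ) : ℤ)) :=
        zpow_le_zpow_right₀ hp1.le (by omega)
    _ = _ := by
      rw [zpow_sub₀ (by positivity), zpow_natCast, inv_pow, div_eq_mul_inv]
      norm_cast

theorem Padic.le_valuation_of_norm_le {x : ℚ_[p]} (hx : x ≠ 0) {m : ℤ}
    (h : ‖x‖ ≤ (p : ℝ) ^ (-m)) : m ≤ x.valuation := by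
  rw [Padic.norm_eq_zpow_neg_valuation hx] at h
  have hp1 : (1 : ℝ) < p := by exact_mod_cast (Fact.out : p.Prime).one_lt
  linarith [(zpow_le_zpow_iff_right₀ hp1).1 h]

end Coefficients

/-! ### The main theorem -/

theorem proposition2 (p : ℕ) [Fact p.Prime] (hp : Odd p) (k : ZMod (p - 1)) (hk : Even k) :
    ∃ a : ℕ → ℚ_[p],
      (∀ n : ℕ, (n : ZMod (p - 1)) = k →
        Summable (fun i : ℕ => a i * (n : ℚ_[p]) ^ i) ∧
        ((bernoulli n : ℚ) : ℚ_[p]) =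
          (1 - (p : ℚ_[p]) ^ ((n : ℤ) - 1))⁻¹ * ∑' i : ℕ, a i * (n : ℚ_[p]) ^ i) ∧
      a 0 = (if k = 0 then 1 - 1 / (p : ℚ_[p]) else 0) ∧
      (∀ i : ℕ, a i ≠ 0 →
        ((p : ℚ) - 2) / ((p : ℚ) - 1) * (i : ℚ) - 2 ≤ ((a i).valuation : ℚ)) ∧
      (∀ i : ℕ, i + 2 ≤ p → a i ≠ 0 → (i : ℤ) - 1 ≤ (a i).valuation) := by
  have hpp : p.Prime := Fact.out
  have hp3 : 3 ≤ p := by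
    have := hpp.two_le
    rcases hp with ⟨m, rfl⟩
    omega
  have hp1 : (1 : ℝ) ≤ p := by exact_mod_cast hpp.one_lt.le
  have : NeZero (p - 1) := ⟨by omega⟩
  have hpos : ∀ z : ℤ, (0 : ℝ) ≤ (p : ℝ) ^ z := fun z => by positivity
  refine ⟨Padic.newtonCoeff (Padic.bernoulliNewton p k.val), fun n hn => ?_, ?_,
    fun i hi => ?_, fun i hip hi => ?_⟩
  · have hmod : n ≡ k.val [MOD p - 1] := by
      rw [← ZMod.natCast_eq_natCast_iff, hn, ZMod.natCast_zmod_val]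
    have hsum := Padic.hasSum_newtonCoeff_mul_pow (Padic.tendsto_bernoulliNewton hp k.val) n
    refine ⟨hsum.summable, ?_⟩
    rw [hsum.tsum_eq, ← Padic.euler_factor_mul_bernoulli hmod, inv_mul_cancel_left₀]
    -- The Euler factor vanishes only at n = 1, which is excluded because k and p - 1 are even.
    have hn1 : n ≠ 1 := by
      rintro rfl
      have h2 : 2 ∣ p - 1 := by
        rcases hp with ⟨m, rfl⟩
        exact ⟨m, by omega⟩
      have h3 := hk.map (ZMod.castHom h2 (ZMod 2))
      rw [← hn, Nat.cast_one, map_one] at h3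
      obtain ⟨r, hr⟩ := h3
      rw [CharTwo.add_self_eq_zero] at hr
      exact one_ne_zero hr
    intro h0
    have h1 : ‖(p : ℚ_[p]) ^ ((n : ℤ) - 1)‖ = 1 := by
      rw [← sub_eq_zero.1 h0, norm_one]
    rw [Padic.norm_p_zpow] at h1
    have h2 := (zpow_eq_one_iff_right₀ (by positivity) (by
      have := hpp.one_lt; exact_mod_cast this.ne')).1 h1
    omega
  · rw [Padic.newtonCoeff_zero, Padic.bernoulliNewton_zero]
    refine if_congr ?_ rfl rfl
    rw [← ZMod.natCast_eq_zero_iff, ZMod.natCast_zmod_val]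
  · have hq : (0 : ℚ) < (p : ℚ) - 1 := by
      have : (3 : ℚ) ≤ p := by exact_mod_cast hp3
      linarith
    rw [← Int.ceil_le]
    refine Padic.le_valuation_of_norm_le hi
      (Padic.norm_newtonCoeff_le (hpos _) fun j hij => ?_)
    refine (Padic.norm_bernoulliNewton_le hp zero_le_one _ j fun _ => le_rfl).trans
      (zpow_le_zpow_right₀ hp1 ?_)
    suffices h : ⌈((p : ℚ) - 2) / ((p : ℚ) - 1) * (i : ℚ) - 2⌉ ≤
        (j : ℤ) - padicValNat p j.factorial - 2 by linarith
    rw [Int.ceil_le]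
    have hvZ := sub_one_mul_padicValNat_factorial_le (p := p) j
    generalize padicValNat p j.factorial = v at hvZ ⊢
    push_cast
    have hv : ((p : ℚ) - 1) * v ≤ j := by
      have : (((p : ℤ) - 1) * v : ℤ) ≤ ((j : ℤ) : ℚ) := Int.cast_le.2 hvZ
      push_cast at this
      exact this
    have hij' : (i : ℚ) ≤ j := by exact_mod_cast hij
    have h2 : (0 : ℚ) ≤ ((p : ℚ) - 2) / ((p : ℚ) - 1) := by
      have : (3 : ℚ) ≤ p := by exact_mod_cast hp3
      exact div_nonneg (by linarith) hq.le
    have h3 : (v : ℚ) ≤ j / ((p : ℚ) - 1) := by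
      rw [le_div_iff₀ hq]; linarith
    have h4 : ((p : ℚ) - 2) / ((p : ℚ) - 1) * j = j - j / ((p : ℚ) - 1) := by
      field_simp
      ring
    linarith [mul_le_mul_of_nonneg_left hij' h2]
  · refine Padic.le_valuation_of_norm_le hi
      (Padic.norm_newtonCoeff_le (hpos _) fun j hij => ?_)
    rcases lt_or_ge j p with hj | hj
    · have hv : padicValNat p j.factorial = 0 :=
        padicValNat.eq_zero_of_not_dvd (by rw [hpp.dvd_factorial]; omega)
      -- For j = p - 1 a factor p is lost, harmlessly since i ≤ p - 2; for smaller j nothing is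
      -- lost.
      rcases Nat.lt_or_ge p (j + 2) with hj2 | hj2
      · refine (Padic.norm_bernoulliNewton_le hp zero_le_one _ j fun _ => le_rfl).trans
          (zpow_le_zpow_right₀ hp1 ?_)
        rw [hv]
        push_cast
        omega
      · refine (Padic.norm_bernoulliNewton_le hp le_rfl _ j fun h => by omega).trans
          (zpow_le_zpow_right₀ hp1 ?_)
        rw [hv]
        push_cast
        omega
    · refine (Padic.norm_bernoulliNewton_le hp zero_le_one _ j fun _ => le_rfl).trans
        (zpow_le_zpow_right₀ hp1 ?_)
      have hlt := sub_one_mul_padicValNat_factorial_lt_of_ne_zero p (n := j) (by omega)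
      generalize padicValNat p j.factorial = v at hlt ⊢
      zify [hpp.one_lt.le] at hlt hj hip hp3
      have hv : (v : ℤ) ≤ j - (p - 1) := by
        by_contra! hcon
        nlinarith [mul_nonneg (sub_nonneg.2 hj) (by linarith : (0 : ℤ) ≤ (p : ℤ) - 2)]
      linarith
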